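/- Let $n \ge 0$ and $k \ge 1$ be integers, let $c$ be a real number, and let $p$ be a real polynomial in one variable of degree $d$ (the zero polynomial is given degree $0$) such that $0 \le p(i) \le 1$ for all $i = 0, 1, \ldots, n$ and $\sup_{t \in [0,n]} |p^{(k)}(t)| \ge c$. Assume that $d$ and $c$ are not both $0$. Then either $d^2 \ge \sqrt{6}\, n$ (which is always the case when $n = 0$), or the ratio $x = d^2/n$ satisfies $$\left(1 - \frac{x^2}{6}\right) \frac{(2k-1)!!}{2^{k-1}}\, c < x^k,$$ where $(2k-1)!! = (2k-1)(2k-3)\cdots 3 \cdot 1$. -/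

import Mathlib

/-! Centre by setting `q = p - 1/2`, and let `M` be the maximum of `|q|` on `[0, n]`. V. A. Markov's
inequality bounds `|q^(j)|` there by `(2/n)^j M T_d^(j)(1)`. A maximum of `|q|` lies within `1/2` of
an integer, where `|q| ≤ 1/2`, so the case `j = 2` together with `T_d''(1) = d²(d² - 1)/3` gives `M
(1 - x²/6) < 1/2`. The case `j = k` together with `(2k-1)!! T_d^(k)(1) ≤ d^(2k)` bounds `c`;
multiplying the two estimates gives the claim.

Most of the file proves Markov's inequality in the manner of Duffin and Schaeffer. Generating
functions give `|T_n(x + iy)| ≤ |T_n(1 + iy)|` for `|x| ≤ 1`. At the zeros of `T_n`, `|P'| ≤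
|T_n'|`, so interpolation there writes `P'` as a contraction of the sum over zeros that defines
`T_n'`. Reflecting the zeros into the left half-plane then yields `|P'(x + iy)| ≤ |T_n'(1 + iy)|`.
Domination on a vertical line extends to the half-plane on its right by Phragmén–Lindelöf and passes
to derivatives by Gauss–Lucas. -/

open Polynomial

/-! ### Domination of polynomials in the right half-plane. -/

namespace Polynomial

open Complex Filter Bornology

/-- A polynomial quotient without poles in the closed right half-plane and bounded at infinity
obeys the maximum principle with respect to the imaginary axis. -/
theorem norm_eval_le_of_forall_mul_I {f g : ℂ[X]} (hdeg : f.degree ≤ g.degree)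
    (hg : ∀ z : ℂ, 0 ≤ z.re → g.eval z ≠ 0)
    (h : ∀ y : ℝ, ‖f.eval (y * I)‖ ≤ ‖g.eval (y * I)‖) {z : ℂ} (hz : 0 ≤ z.re) :
    ‖f.eval z‖ ≤ ‖g.eval z‖ := by
  have hO : (fun z : ℂ => f.eval z / g.eval z) =O[cobounded ℂ] fun _ => (1 : ℝ) := by
    have h1 := isBigO_cobounded_of_degree_le (P := f) (Q := g) hdeg
    obtain ⟨c, hc⟩ := h1.bound
    refine Asymptotics.IsBigO.of_bound (max c 0) ?_
    filter_upwards [hc] with w hw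
    rw [norm_div, norm_one, mul_one]
    refine div_le_of_le_mul₀ (norm_nonneg _) (le_max_right _ _) (hw.trans ?_)
    gcongr
    exact le_max_left _ _
  have key := PhragmenLindelof.right_half_plane_of_bounded_on_real
    (f := fun z : ℂ => f.eval z / g.eval z) (C := 1) ?_ ?_ ?_ ?_ hz
  · rw [norm_div, div_le_one (norm_pos_iff.mpr (hg z hz))] at key
    exact key
  · refine DifferentiableOn.diffContOnCl ?_
    rw [closure_setOfPred_lt_re]
    exact fun w hw => (f.differentiable.differentiableAt.div g.differentiable.differentiableAt
      (hg w hw)).differentiableWithinAt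
  -- Growth `O(exp(B |z|^c))` with `c = 1 < 2` and `B = 0`, that is, boundedness.
  · refine ⟨1, by norm_num, 0, ?_⟩
    simpa using hO.mono inf_le_left
  · obtain ⟨c, hc⟩ := hO.bound
    have ht : Tendsto (fun x : ℝ => (x : ℂ)) atTop (cobounded ℂ) := by
      rw [← tendsto_norm_atTop_iff_cobounded]
      simpa using tendsto_abs_atTop_atTop
    refine ⟨c, ?_⟩
    rw [eventually_map]
    filter_upwards [ht.eventually hc] with x hx
    simpa using hx
  · intro y
    rw [norm_div]
    exact div_le_one_of_le₀ (h y) (norm_nonneg _)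

/-- Gauss–Lucas: the zeros of `g'` lie in the convex hull of those of `g`, hence in the open left
half-plane. -/
theorem eval_derivative_ne_zero_of_forall_re_nonneg {g : ℂ[X]} (hd : 0 < g.natDegree)
    (hg : ∀ z : ℂ, 0 ≤ z.re → g.eval z ≠ 0) {z : ℂ} (hz : 0 ≤ z.re) :
    g.derivative.eval z ≠ 0 := by
  intro h0
  have hg0 : g.derivative ≠ 0 := fun h => by
    have := derivative_eq_zero.mp h
    omega
  have hmem : z ∈ g.derivative.rootSet ℂ := by
    rw [mem_rootSet]
    exact ⟨hg0, by simpa using h0⟩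
  have h1 := rootSet_derivative_subset_convexHull_rootSet (natDegree_pos_iff_degree_pos.mp hd) hmem
  have h2 : convexHull ℝ (g.rootSet ℂ) ⊆ {w : ℂ | w.re < 0} := by
    refine convexHull_min (fun w hw => ?_) (convex_halfSpace_re_lt 0)
    rw [mem_rootSet] at hw
    by_contra hw0
    exact hg w (not_lt.mp hw0) (by simpa using hw.2)
  exact absurd (h2 h1) (not_lt.mpr hz)

/-- If the conclusion failed at `z`, then `l = f'(z)/g'(z)` would have `‖l‖ > 1`, so `l g - f` would
be zero-free in the half-plane while its derivative vanishes at `z`. This contradicts Gauss–Lucas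
unless `l g - f` is constant. -/
theorem norm_eval_derivative_le_of_forall_re_nonneg {f g : ℂ[X]} (hdeg : f.natDegree ≤ g.natDegree)
    (hg : ∀ z : ℂ, 0 ≤ z.re → g.eval z ≠ 0)
    (h : ∀ z : ℂ, 0 ≤ z.re → ‖f.eval z‖ ≤ ‖g.eval z‖) {z : ℂ} (hz : 0 ≤ z.re) :
    ‖f.derivative.eval z‖ ≤ ‖g.derivative.eval z‖ := by
  rcases Nat.eq_zero_or_pos g.natDegree with hd | hd
  · rw [derivative_of_natDegree_zero (by omega : f.natDegree = 0)]
    simp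
  by_contra! hlt
  have hg' := eval_derivative_ne_zero_of_forall_re_nonneg hd hg hz
  set l : ℂ := f.derivative.eval z / g.derivative.eval z with hl
  have hl1 : 1 < ‖l‖ := by
    rw [hl, norm_div, one_lt_div (norm_pos_iff.mpr hg')]
    exact hlt
  have hne : ∀ w : ℂ, 0 ≤ w.re → (C l * g - f).eval w ≠ 0 := by
    intro w hw h0
    rw [eval_sub, eval_mul, eval_C, sub_eq_zero] at h0
    have h1 := h w hw
    rw [← h0, norm_mul] at h1
    have h2 := norm_pos_iff.mpr (hg w hw)
    nlinarith
  have hz0 : (C l * g - f).derivative.eval z = 0 := by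
    simp [hl, hg']
  rcases Nat.eq_zero_or_pos (C l * g - f).natDegree with hd0 | hd0
  · obtain ⟨a, ha⟩ := natDegree_eq_zero.mp hd0
    -- then `‖l * g‖ ≤ ‖g‖ + ‖a‖` in the half-plane, although `g` is unbounded there
    have hf : f = C l * g - C a := by rw [ha]; ring
    have hb : ∀ w : ℂ, 0 ≤ w.re → (‖l‖ - 1) * ‖g.eval w‖ ≤ ‖a‖ := by
      intro w hw
      have h1 := h w hw
      rw [hf, eval_sub, eval_mul, eval_C, eval_C] at h1
      have h2 := norm_sub_norm_le (l * g.eval w) a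
      rw [norm_mul] at h2
      linarith
    have ht : Tendsto (fun x : ℝ => ‖g.eval (x : ℂ)‖) atTop atTop := by
      refine g.tendsto_norm_atTop (natDegree_pos_iff_degree_pos.mp hd) ?_
      simpa using tendsto_abs_atTop_atTop
    obtain ⟨x, hx, hx0⟩ := ((ht.eventually_gt_atTop (‖a‖ / (‖l‖ - 1))).and
      (eventually_ge_atTop (0 : ℝ))).exists
    have h3 := hb (x : ℂ) (by simpa using hx0)
    rw [div_lt_iff₀ (by linarith)] at hx
    linarith
  · exact eval_derivative_ne_zero_of_forall_re_nonneg hd0 hne hz hz0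

/-- The hypotheses reproduce themselves: by Gauss–Lucas `g'` is again zero-free, unless `g` is
constant. -/
theorem norm_eval_iterate_derivative_le_of_forall_re_nonneg (k : ℕ) {f g : ℂ[X]}
    (hdeg : f.natDegree ≤ g.natDegree)
    (hg : ∀ z : ℂ, 0 ≤ z.re → g.eval z ≠ 0)
    (h : ∀ z : ℂ, 0 ≤ z.re → ‖f.eval z‖ ≤ ‖g.eval z‖) {z : ℂ} (hz : 0 ≤ z.re) :
    ‖(derivative^[k] f).eval z‖ ≤ ‖(derivative^[k] g).eval z‖ := by
  induction k generalizing f g with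
  | zero => exact h z hz
  | succ k ih =>
    rw [Function.iterate_succ_apply, Function.iterate_succ_apply]
    rcases Nat.eq_zero_or_pos g.natDegree with hd | hd
    · rw [derivative_of_natDegree_zero (by omega : f.natDegree = 0)]
      simp
    · refine ih ?_ (fun w hw => eval_derivative_ne_zero_of_forall_re_nonneg hd hg hw)
        (fun w hw => norm_eval_derivative_le_of_forall_re_nonneg hdeg hg h hw)
      rw [natDegree_derivative, natDegree_derivative]
      omega

end Polynomial

/-! ### Majorization of power series. -/

namespace PowerSeries

/-- Coefficientwise majorization of real power series. -/
def MajorizedBy (f g : PowerSeries ℝ) : Prop := ∀ n, |coeff n f| ≤ coeff n g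

namespace MajorizedBy

variable {f f₁ f₂ g g₁ g₂ : PowerSeries ℝ}

theorem nonneg (h : MajorizedBy f g) (n : ℕ) : 0 ≤ coeff n g := (abs_nonneg _).trans (h n)

theorem add (h₁ : MajorizedBy f₁ g₁) (h₂ : MajorizedBy f₂ g₂) :
    MajorizedBy (f₁ + f₂) (g₁ + g₂) := fun n => by
  rw [map_add, map_add]
  exact (abs_add_le _ _).trans (add_le_add (h₁ n) (h₂ n))

theorem mul (h₁ : MajorizedBy f₁ g₁) (h₂ : MajorizedBy f₂ g₂) :
    MajorizedBy (f₁ * f₂) (g₁ * g₂) := fun n => by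
  rw [coeff_mul, coeff_mul]
  refine (Finset.abs_sum_le_sum_abs _ _).trans (Finset.sum_le_sum fun i _ => ?_)
  rw [abs_mul]
  exact mul_le_mul (h₁ _) (h₂ _) (abs_nonneg _) (h₁.nonneg _)

theorem derivative (h : MajorizedBy f g) :
    MajorizedBy (derivative ℝ f) (derivative ℝ g) := fun n => by
  rw [coeff_derivative, coeff_derivative, abs_mul, abs_of_nonneg (by positivity : (0 : ℝ) ≤ n + 1)]
  exact mul_le_mul_of_nonneg_right (h _) (by positivity)

/-- Here `f₁ = 1/(1 - f)` and `g₁ = 1/(1 - g)`; zero constant terms make the equations recursions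
for the coefficients. -/
theorem geometric (h : MajorizedBy f g) (hg : constantCoeff g = 0) (hf₁ : f₁ = 1 + f * f₁)
    (hg₁ : g₁ = 1 + g * g₁) : MajorizedBy f₁ g₁ := fun n => by
  have h0 : coeff 0 g = 0 := by simpa using hg
  have h0' : coeff 0 f = 0 := by simpa [h0] using h 0
  induction n using Nat.strong_induction_on with
  | _ n ih =>
    have h1 : |coeff n (1 : PowerSeries ℝ)| ≤ coeff n (1 : PowerSeries ℝ) := by
      rw [coeff_one]; split_ifs <;> simp
    rw [hf₁, hg₁, map_add, map_add, coeff_mul, coeff_mul]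
    refine (abs_add_le _ _).trans (add_le_add h1 ?_)
    refine (Finset.abs_sum_le_sum_abs _ _).trans (Finset.sum_le_sum fun i hi => ?_)
    rw [abs_mul]
    rcases Nat.eq_zero_or_pos i.1 with h2 | h2
    · rw [h2, h0, h0']; simp
    · exact mul_le_mul (h _) (ih _ (by rw [Finset.HasAntidiagonal.mem_antidiagonal] at hi; omega)) (abs_nonneg _)
        (h.nonneg _)

theorem of_nonneg (h : ∀ n, 0 ≤ coeff n f) : MajorizedBy f f := fun n =>
  (abs_of_nonneg (h n)).le

end MajorizedBy

end PowerSeries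

/-! ### Comparison of `T_n` on vertical lines by generating functions. -/

namespace Polynomial.Chebyshev

open PowerSeries (mk coeff constantCoeff MajorizedBy coeff_mk)

theorem one_sub_mul_add_sq_mul_mk_U (s : ℝ) :
    (1 - 2 * PowerSeries.C s * PowerSeries.X + PowerSeries.X ^ 2) *
      mk (fun n => (U ℝ n).eval s) = 1 := by
  ext n
  have e : (1 - 2 * PowerSeries.C s * PowerSeries.X + PowerSeries.X ^ 2) *
      mk (fun n => (U ℝ n).eval s) = mk (fun n => (U ℝ n).eval s) -
      PowerSeries.X * (PowerSeries.C (2 * s) * mk (fun n => (U ℝ n).eval s)) +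
      PowerSeries.X * (PowerSeries.X * mk (fun n => (U ℝ n).eval s)) := by
    rw [map_mul, map_ofNat]; ring
  rw [e]
  rcases n with _ | _ | n
  · simp
  · simp [PowerSeries.coeff_succ_X_mul, PowerSeries.coeff_one]
  · simp only [map_add, map_sub, PowerSeries.coeff_succ_X_mul, PowerSeries.coeff_C_mul, coeff_mk,
      PowerSeries.coeff_one]
    have := congrArg (Polynomial.eval s) (U_add_two ℝ (n : ℤ))
    simp only [eval_sub, eval_mul, eval_X, eval_ofNat] at this
    push_cast
    rw [show (n : ℤ) + 1 + 1 = n + 2 by ring, this]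
    simp

theorem one_sub_mul_add_sq_mul_mk_T (s : ℝ) :
    (1 - 2 * PowerSeries.C s * PowerSeries.X + PowerSeries.X ^ 2) *
      mk (fun n => (T ℝ (n + 1)).eval s) = PowerSeries.C s - PowerSeries.X := by
  ext n
  have e : (1 - 2 * PowerSeries.C s * PowerSeries.X + PowerSeries.X ^ 2) *
      mk (fun n => (T ℝ (n + 1)).eval s) = mk (fun n => (T ℝ (n + 1)).eval s) -
      PowerSeries.X * (PowerSeries.C (2 * s) * mk (fun n => (T ℝ (n + 1)).eval s)) +
      PowerSeries.X * (PowerSeries.X * mk (fun n => (T ℝ (n + 1)).eval s)) := by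
    rw [map_mul, map_ofNat]; ring
  rw [e]
  rcases n with _ | _ | n
  · simp
  · simp [PowerSeries.coeff_succ_X_mul, one_add_one_eq_two, T_two]
    ring
  · simp only [map_add, map_sub, PowerSeries.coeff_succ_X_mul, PowerSeries.coeff_C_mul, coeff_mk,
      PowerSeries.coeff_C, PowerSeries.coeff_X]
    have := congrArg (Polynomial.eval s) (T_add_two ℝ (n + 1 : ℤ))
    simp only [eval_sub, eval_mul, eval_X, eval_ofNat] at this
    push_cast
    rw [show (n : ℤ) + 1 + 1 + 1 = n + 1 + 2 by ring, this]
    simp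

/-- The auxiliary series `4 Y r (1 + r)² / ((1 - r)² (1 - 2 s r + r²))`. -/
noncomputable def auxSeries (s Y : ℝ) : PowerSeries ℝ :=
  PowerSeries.C (4 * Y) * PowerSeries.X * (1 + PowerSeries.X) ^ 2 *
    (mk (fun _ => (1 : ℝ))) ^ 2 * mk (fun n => (U ℝ n).eval s)

theorem constantCoeff_auxSeries (s Y : ℝ) : PowerSeries.constantCoeff (auxSeries s Y) = 0 := by
  simp [auxSeries]

theorem one_sub_auxSeries_mul_inv (s Y : ℝ) :
    (1 - auxSeries s Y) * (1 - auxSeries s Y)⁻¹ = 1 :=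
  PowerSeries.mul_inv_cancel _ (by simp [constantCoeff_auxSeries])

/-- The series of `T_(n+1)(u)` is `-1/2` times the logarithmic derivative of `1 - 2ur + r²`. The
identity is thus the logarithmic derivative of `(1 - 2ur + r²)(1 - 2vr + r²) = (1 - r)²(1 - 2sr +
r²)(1 - W)`, with `W` the auxiliary series. -/
theorem mk_T_add_mk_T_eq {s Y u v : ℝ} (hadd : u + v = s + 1 + 2 * Y)
    (hmul : u * v = s - 2 * Y) :
    2 * (mk (fun n => (T ℝ (n + 1)).eval u) + mk (fun n => (T ℝ (n + 1)).eval v)) =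
      2 * mk (fun _ => (1 : ℝ)) + 2 * mk (fun n => (T ℝ (n + 1)).eval s) +
        PowerSeries.derivative ℝ (auxSeries s Y) * (1 - auxSeries s Y)⁻¹ := by
  have h2 : PowerSeries.C (2 : ℝ) = 2 := map_ofNat _ 2
  have h4 : PowerSeries.C (4 : ℝ) = 4 := map_ofNat _ 4
  have hd2 : PowerSeries.derivative ℝ (2 : PowerSeries ℝ) = 0 := by
    rw [← h2, PowerSeries.derivative_C]
  have hd4 : PowerSeries.derivative ℝ (4 : PowerSeries ℝ) = 0 := by
    rw [← h4, PowerSeries.derivative_C]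
  have hR : (1 - PowerSeries.X) * mk (fun _ => (1 : ℝ)) = 1 := by
    rw [mul_comm]; exact PowerSeries.mk_one_mul_one_sub_eq_one ℝ
  have hA := one_sub_mul_add_sq_mul_mk_U s
  have hB := one_sub_mul_add_sq_mul_mk_T s
  have hu := one_sub_mul_add_sq_mul_mk_T u
  have hv := one_sub_mul_add_sq_mul_mk_T v
  have hF := one_sub_auxSeries_mul_inv s Y
  have hadd' : PowerSeries.C u + PowerSeries.C v =
      PowerSeries.C s + 1 + 2 * PowerSeries.C Y := by
    rw [← map_add, hadd]; simp [h2]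
  have hmul' : PowerSeries.C u * PowerSeries.C v =
      PowerSeries.C s - 2 * PowerSeries.C Y := by
    rw [← map_mul, hmul]; simp [h2]
  have hW : (1 - PowerSeries.X) ^ 2 *
      (1 - 2 * PowerSeries.C s * PowerSeries.X + PowerSeries.X ^ 2) * auxSeries s Y =
      4 * PowerSeries.C Y * PowerSeries.X * (1 + PowerSeries.X) ^ 2 := by
    rw [auxSeries, map_mul, h4]
    calc _ = (4 * PowerSeries.C Y * PowerSeries.X * (1 + PowerSeries.X) ^ 2) *
          ((1 - PowerSeries.X) * mk (fun _ => (1 : ℝ))) ^ 2 *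
          ((1 - 2 * PowerSeries.C s * PowerSeries.X + PowerSeries.X ^ 2) *
            mk (fun n => (U ℝ n).eval s)) := by ring
      _ = _ := by rw [hR, hA]; ring
  have hdW := congrArg (PowerSeries.derivative ℝ) hW
  simp only [Derivation.leibniz, Derivation.leibniz_pow, map_add, map_sub, hd2, hd4,
    PowerSeries.derivative_C, PowerSeries.derivative_X, smul_eq_mul, nsmul_eq_mul,
    Derivation.map_one_eq_zero] at hdW
  norm_num at hdW
  -- From here only ring relations matter; denominators are cleared by cancelling a unit.
  generalize auxSeries s Y = W at *
  generalize (1 - W)⁻¹ = F at *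
  generalize mk (fun _ => (1 : ℝ)) = R at *
  generalize mk (fun n => (U ℝ n).eval s) = A at *
  generalize mk (fun n => (T ℝ (n + 1)).eval s) = B at *
  generalize mk (fun n => (T ℝ (n + 1)).eval u) = Bu at *
  generalize mk (fun n => (T ℝ (n + 1)).eval v) = Bv at *
  generalize PowerSeries.derivative ℝ W = W' at *
  generalize PowerSeries.C u = u' at *
  generalize PowerSeries.C v = v' at *
  generalize PowerSeries.C s = s' at *
  generalize PowerSeries.C Y = Y' at *
  generalize (PowerSeries.X : PowerSeries ℝ) = X at *
  have hH : (1 - 2 * u' * X + X ^ 2) * (1 - 2 * v' * X + X ^ 2) =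
      (1 - X) ^ 2 * (1 - 2 * s' * X + X ^ 2) * (1 - W) := by
    linear_combination -2 * X * (1 + X ^ 2) * hadd' + 4 * X ^ 2 * hmul' + hW
  have hne : (1 - 2 * u' * X + X ^ 2) * (1 - 2 * v' * X + X ^ 2) ≠ 0 := by
    refine left_ne_zero_of_mul_eq_one (b := R ^ 2 * A * F) ?_
    rw [hH]
    calc _ = ((1 - X) * R) ^ 2 * ((1 - 2 * s' * X + X ^ 2) * A) * ((1 - W) * F) := by ring
      _ = 1 := by rw [hR, hA, hF]; ring
  refine mul_left_cancel₀ hne ?_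
  linear_combination 2 * (1 - 2 * v' * X + X ^ 2) * hu + 2 * (1 - 2 * u' * X + X ^ 2) * hv +
    2 * (1 + 3 * X ^ 2) * hadd' - 8 * X * hmul' - (2 * R + 2 * B + W' * F) * hH -
    2 * (1 - X) * (1 - 2 * s' * X + X ^ 2) * (1 - W) * hR - 2 * (1 - X) ^ 2 * (1 - W) * hB -
    (1 - X) ^ 2 * (1 - 2 * s' * X + X ^ 2) * W' * hF - hdW

/-- With `x + iy = cos(α + iβ)`, the identity `2|cos(n(α + iβ))|² = cos 2nα + cosh 2nβ` suggests `u
= cos 2α` and `v = cosh 2β`. -/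
theorem exists_T_add_T_eq_norm_sq (x y : ℝ) :
    ∃ u v : ℝ, u + v = 2 * x ^ 2 + 2 * y ^ 2 ∧ u * v = 2 * x ^ 2 - 1 - 2 * y ^ 2 ∧
      ∀ n : ℤ, (T ℝ n).eval u + (T ℝ n).eval v =
        2 * ‖(T ℂ n).eval (x + y * Complex.I)‖ ^ 2 := by
  obtain ⟨a, ha⟩ := Complex.cos_surjective (x + y * Complex.I)
  have hnorm : ∀ p q : ℝ, ‖Complex.cos (p + q * Complex.I)‖ ^ 2 =
      Real.cos p ^ 2 + Real.cosh q ^ 2 - 1 := by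
    intro p q
    rw [Complex.cos_add_mul_I, ← Complex.normSq_eq_norm_sq, ← Complex.ofReal_cos,
      ← Complex.ofReal_cosh, ← Complex.ofReal_sin, ← Complex.ofReal_sinh, Complex.normSq_apply]
    simp only [Complex.sub_re, Complex.sub_im, Complex.mul_re, Complex.mul_im, Complex.ofReal_re,
      Complex.ofReal_im, Complex.I_re, Complex.I_im]
    have h1 := Real.sin_sq_add_cos_sq p
    have h2 := Real.cosh_sq q
    ring_nf
    linear_combination (Real.sinh q ^ 2) * h1 + (Real.cos p ^ 2 - 1) * h2
  have hxy : x = Real.cos a.re * Real.cosh a.im ∧ y = -(Real.sin a.re * Real.sinh a.im) := by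
    rw [← Complex.re_add_im a, Complex.cos_add_mul_I, ← Complex.ofReal_cos,
      ← Complex.ofReal_cosh, ← Complex.ofReal_sin, ← Complex.ofReal_sinh] at ha
    constructor
    · have := congrArg Complex.re ha
      simp only [Complex.sub_re, Complex.add_re, Complex.mul_re, Complex.mul_im,
        Complex.ofReal_re, Complex.ofReal_im, Complex.I_re, Complex.I_im] at this
      linarith
    · have := congrArg Complex.im ha
      simp only [Complex.sub_im, Complex.add_im, Complex.mul_re, Complex.mul_im,
        Complex.ofReal_re, Complex.ofReal_im, Complex.I_re, Complex.I_im] at this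
      linarith
  have h1 := Real.sin_sq_add_cos_sq a.re
  have h2 := Real.cosh_sq a.im
  refine ⟨Real.cos (2 * a.re), Real.cosh (2 * a.im), ?_, ?_, fun n => ?_⟩
  · rw [Real.cos_two_mul, Real.cosh_two_mul, hxy.1, hxy.2]
    have h3 : Real.sin a.re ^ 2 = 1 - Real.cos a.re ^ 2 := by linarith
    have h4 : Real.sinh a.im ^ 2 = Real.cosh a.im ^ 2 - 1 := by linarith
    rw [neg_sq, mul_pow, mul_pow, h3, h4]; ring
  · rw [Real.cos_two_mul, Real.cosh_two_mul, hxy.1, hxy.2]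
    have h3 : Real.sin a.re ^ 2 = 1 - Real.cos a.re ^ 2 := by linarith
    have h4 : Real.sinh a.im ^ 2 = Real.cosh a.im ^ 2 - 1 := by linarith
    rw [neg_sq, mul_pow, mul_pow, h3, h4]; ring
  · rw [T_real_cos, T_real_cosh, ← ha, T_complex_cos]
    have e : (n : ℂ) * a = ((n * a.re : ℝ) : ℂ) + ((n * a.im : ℝ) : ℂ) * Complex.I := by
      conv_lhs => rw [← Complex.re_add_im a]
      push_cast; ring
    rw [e, hnorm, show (n : ℝ) * (2 * a.re) = 2 * (n * a.re) by ring,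
      show (n : ℝ) * (2 * a.im) = 2 * (n * a.im) by ring, Real.cos_two_mul, Real.cosh_two_mul]
    have h5 := Real.cosh_sq (n * a.im)
    linarith

theorem abs_eval_U_real_le (n : ℕ) {s : ℝ} (hs : |s| ≤ 1) : |(U ℝ n).eval s| ≤ (U ℝ n).eval 1 := by
  have h1 := abs_iterate_derivative_T_real_le (n + 1 : ℤ) 1 hs
  simp only [Function.iterate_one, T_derivative_eq_U, add_sub_cancel_right, eval_mul, abs_mul] at h1
  have e : ∀ t : ℝ, (((n : ℤ) + 1 : ℤ) : ℝ[X]).eval t = n + 1 := by intro t; simp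
  rw [e, e, abs_of_pos (by positivity)] at h1
  exact le_of_mul_le_mul_left h1 (by positivity)

/-- Put `s = 2x² - 1` and `Y = y² ≥ 0`. Replacing `s` by `1` majorizes every ingredient of the
generating function of `2‖T_n‖²`, since `|T_n(s)| ≤ T_n(1)` and `|U_n(s)| ≤ U_n(1)`. -/
theorem norm_eval_T_le (n : ℕ) {x : ℝ} (hx : |x| ≤ 1) (y : ℝ) :
    ‖(T ℂ n).eval (x + y * Complex.I)‖ ≤ ‖(T ℂ n).eval (1 + y * Complex.I)‖ := by
  rcases n with _ | n
  · simp
  set s : ℝ := 2 * x ^ 2 - 1 with hs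
  have hx1 : x ^ 2 ≤ 1 := by rwa [sq_le_one_iff_abs_le_one]
  have hs1 : |s| ≤ 1 := by rw [abs_le]; constructor <;> nlinarith [sq_nonneg x]
  have hY := sq_nonneg y
  obtain ⟨u, v, huv, huv', hT⟩ := exists_T_add_T_eq_norm_sq x y
  obtain ⟨u₁, v₁, huv₁, huv₁', hT₁⟩ := exists_T_add_T_eq_norm_sq 1 y
  have e := mk_T_add_mk_T_eq (s := s) (Y := y ^ 2) (u := u) (v := v) (by linarith) (by linarith)
  have e₁ := mk_T_add_mk_T_eq (s := 1) (Y := y ^ 2) (u := u₁) (v := v₁) (by linarith) (by linarith)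
  have m2 : MajorizedBy 2 2 := by
    refine .of_nonneg fun n => ?_
    rw [show (2 : PowerSeries ℝ) = PowerSeries.C 2 from (map_ofNat _ 2).symm, PowerSeries.coeff_C]
    split_ifs <;> norm_num
  have mR : MajorizedBy (mk fun _ => (1 : ℝ)) (mk fun _ => (1 : ℝ)) :=
    .of_nonneg fun n => by simp
  have mT : MajorizedBy (mk fun n => (T ℝ (n + 1)).eval s) (mk fun n => (T ℝ (n + 1)).eval 1) :=
    fun n => by simpa using abs_eval_T_real_le_one _ hs1
  have mU : MajorizedBy (mk fun n => (U ℝ n).eval s) (mk fun n => (U ℝ n).eval 1) :=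
    fun n => by simpa only [coeff_mk] using abs_eval_U_real_le n hs1
  have mX : MajorizedBy PowerSeries.X PowerSeries.X := .of_nonneg fun n => by
    rw [PowerSeries.coeff_X]; split_ifs <;> norm_num
  have m1 : MajorizedBy 1 1 := .of_nonneg fun n => by
    rw [PowerSeries.coeff_one]; split_ifs <;> norm_num
  have mC : MajorizedBy (PowerSeries.C (4 * y ^ 2)) (PowerSeries.C (4 * y ^ 2)) :=
    .of_nonneg fun n => by rw [PowerSeries.coeff_C]; split_ifs <;> positivity
  have mW : MajorizedBy (auxSeries s (y ^ 2)) (auxSeries 1 (y ^ 2)) := by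
    rw [auxSeries, auxSeries, sq (1 + PowerSeries.X), sq (mk _)]
    exact (((mC.mul mX).mul ((m1.add mX).mul (m1.add mX))).mul (mR.mul mR)).mul mU
  have mF : MajorizedBy (1 - auxSeries s (y ^ 2))⁻¹ (1 - auxSeries 1 (y ^ 2))⁻¹ :=
    mW.geometric (constantCoeff_auxSeries _ _)
      (by linear_combination one_sub_auxSeries_mul_inv s (y ^ 2))
      (by linear_combination one_sub_auxSeries_mul_inv 1 (y ^ 2))
  have m := ((m2.mul mR).add (m2.mul mT)).add (mW.derivative.mul mF)
  rw [← e, ← e₁] at m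
  have mn := m n
  rw [← map_ofNat PowerSeries.C 2, PowerSeries.coeff_C_mul, PowerSeries.coeff_C_mul, map_add,
    map_add, coeff_mk, coeff_mk, coeff_mk, coeff_mk, hT, hT₁, abs_of_nonneg (by positivity)] at mn
  push_cast at mn ⊢
  exact le_of_sq_le_sq (by linarith) (norm_nonneg _)

end Polynomial.Chebyshev

/-! ### Extremality of `T_n'` at the zeros of `T_n`. -/

namespace Polynomial.Chebyshev

theorem eval_derivative_T_ne_zero_of_isRoot {n : ℕ} {a : ℝ} (ha : (T ℝ n).IsRoot a) :
    (derivative (T ℝ n)).eval a ≠ 0 := by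
  intro h
  have h1 := (one_lt_rootMultiplicity_iff_isRoot (T_ne_zero ℝ n)).mpr ⟨ha, h⟩
  have h2 : (T ℝ n).roots.Nodup := by rw [roots_T_real]; exact Finset.nodup _
  rw [← count_roots] at h1
  have h3 := Multiset.nodup_iff_count_le_one.mp h2 a
  omega

theorem X_sq_sub_one_mul_U_eq_nodal (n : ℕ) :
    (X ^ 2 - 1) * U ℝ n =
      Polynomial.C ((2 : ℝ) ^ n) * Lagrange.nodal (Finset.range (n + 2)) (node (n + 1)) := by
  have hmon : (X ^ 2 - 1 : ℝ[X]).Monic := by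
    simpa using monic_X_pow_sub_C (1 : ℝ) (n := 2) (by norm_num)
  have hdeg2 : (X ^ 2 - 1 : ℝ[X]).degree = 2 := by
    simpa using degree_X_pow_sub_C (n := 2) (by norm_num) (1 : ℝ)
  have hinj := (strictAntiOn_node (n + 1)).injOn
  have hcard : ((Finset.range (n + 2)).image (node (n + 1))).card = n + 2 := by
    rw [Finset.card_image_of_injOn hinj, Finset.card_range]
  have hd1 : ((X ^ 2 - 1) * U ℝ n : ℝ[X]).degree = (n + 2 : ℕ) := by
    rw [degree_mul, hdeg2, degree_U_natCast]
    push_cast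
    ring
  refine eq_of_degree_le_of_eval_finset_eq ((Finset.range (n + 2)).image (node (n + 1))) ?_ ?_ ?_ ?_
  · rw [hd1, hcard]
  · rw [hd1, degree_C_mul (by positivity), Lagrange.degree_nodal, Finset.card_range]
  · rw [leadingCoeff_mul, hmon.leadingCoeff, leadingCoeff_U_natCast, leadingCoeff_mul,
      leadingCoeff_C, (Lagrange.nodal_monic).leadingCoeff]
    ring
  · intro x hx
    obtain ⟨i, hi, rfl⟩ := Finset.mem_image.mp hx
    rw [eval_mul (p := Polynomial.C _), Lagrange.eval_nodal_at_node hi, mul_zero, node]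
    set t : ℝ := i * Real.pi / (n + 1 : ℕ) with ht
    have h1 := U_real_cos t n
    have h2 : ((n : ℤ) + 1 : ℝ) * t = i * Real.pi := by
      rw [ht]; push_cast; field_simp
    rw [h2, Real.sin_nat_mul_pi] at h1
    have h3 := Real.sin_sq_add_cos_sq t
    simp only [eval_mul, eval_sub, eval_pow, eval_X, eval_one]
    linear_combination (-Real.sin t) * h1 + (eval (Real.cos t) (U ℝ n)) * h3

/-- This sign pattern makes the triangle inequality an equality for `T_(n+1)` when its derivative at
`a` is expanded over the extremal nodes. -/
theorem derivative_T_mul_derivative_basis_nonneg {n : ℕ} {a : ℝ}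
    (ha : (T ℝ (n + 1 : ℕ)).IsRoot a) {i : ℕ} (hi : i ∈ Finset.range (n + 2)) :
    0 ≤ (derivative (T ℝ (n + 1 : ℕ))).eval a * ((-1) ^ i *
      (derivative (Lagrange.basis (Finset.range (n + 2)) (node (n + 1)) i)).eval a) := by
  set s := Finset.range (n + 2) with hs
  set v := node (n + 1) with hv
  set D := (derivative (T ℝ (n + 1 : ℕ))).eval a with hD
  have ha1 : |a| ≤ 1 := by
    rw [abs_eval_T_real_le_one_iff (n := ((n + 1 : ℕ) : ℤ)) (by positivity), ha]; simp
  have hdT : derivative (T ℝ (n + 1 : ℕ)) = (n + 1 : ℝ[X]) * U ℝ n := by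
    rw [T_derivative_eq_U]; push_cast; simp
  have hiT : (T ℝ (n + 1 : ℕ)).eval (v i) = (-1) ^ i :=
    eval_T_real_node (by simp only [hs, Finset.mem_range, Finset.mem_Iic] at hi ⊢; omega)
  have hav : a - v i ≠ 0 := fun h => by
    rw [sub_eq_zero] at h
    rw [← h, ha.eq_zero] at hiT
    exact (pow_ne_zero i (by norm_num : (-1 : ℝ) ≠ 0)) hiT.symm
  have hw : 0 < (-1) ^ i * Lagrange.nodalWeight s v i := by
    have := inv_pos_of_pos (zero_lt_prod_node_sub_node (n := n + 1) (i := i)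
      (by simp only [hs, Finset.mem_range] at hi; omega))
    rw [mul_inv, ← inv_pow, inv_neg_one, ← Finset.prod_inv_distrib] at this
    exact this
  set N := Lagrange.nodal (s.erase i) v with hN
  have hbasis : Lagrange.basis s v i = Polynomial.C (Lagrange.nodalWeight s v i) * N := by
    rw [Lagrange.basis_eq_prod_sub_inv_mul_nodal_div hi, ← Lagrange.nodal_erase_eq_nodal_div hi]
  have hnod := X_sq_sub_one_mul_U_eq_nodal n
  rw [Lagrange.nodal_eq_mul_nodal_erase hi] at hnod
  have e0 : (a ^ 2 - 1) * D = (n + 1) * 2 ^ n * ((a - v i) * N.eval a) := by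
    have := congrArg (eval a) hnod
    simp only [eval_mul, eval_sub, eval_pow, eval_X, eval_one, eval_C] at this
    rw [hD, hdT]
    simp only [eval_mul, eval_add, eval_natCast, eval_one]
    linear_combination (n + 1 : ℝ) * this
  -- The Chebyshev differential equation gives `((X² - 1)T')' = X T' + (n+1)² T`, and `T` vanishes
  -- at `a`.
  have e1 : a * D = (n + 1) * 2 ^ n * (N.eval a + (a - v i) * (derivative N).eval a) := by
    have h1 := congrArg (fun q => eval a (derivative q)) hnod
    have h2 := congrArg (eval a) (one_sub_X_sq_mul_derivative_derivative_T_eq_poly_in_T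
      (R := ℝ) ((n + 1 : ℕ) : ℤ))
    rw [Function.iterate_succ_apply, Function.iterate_one, hdT] at h2
    simp only [derivative_mul, derivative_sub, derivative_X, derivative_C, derivative_one,
      derivative_X_pow, derivative_add, derivative_natCast, eval_mul, eval_sub, eval_add,
      eval_pow, eval_X, eval_one, eval_C, eval_natCast, eval_zero, ha.eq_zero, Nat.cast_ofNat] at h1 h2
    rw [hD, hdT]
    simp only [eval_mul, eval_add, eval_natCast, eval_one]
    norm_num at h1 h2
    linear_combination (n + 1 : ℝ) * h1 + h2
  have hk : (0 : ℝ) < (n + 1) * 2 ^ n := by positivity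
  -- Eliminating `N(a)` leaves `1 - a v_i`, which is nonnegative because both points lie in `[-1,
  -- 1]`.
  have e2 : (n + 1) * 2 ^ n * ((a - v i) ^ 2 * (D * (derivative N).eval a)) =
      D ^ 2 * (1 - a * v i) := by
    linear_combination D * e0 - D * (a - v i) * e1
  have hvi : |v i| ≤ 1 := abs_le.mpr node_mem_Icc
  have h3 : a * v i ≤ 1 := by
    refine (le_abs_self _).trans ?_
    rw [abs_mul]
    exact mul_le_one₀ ha1 (abs_nonneg _) hvi
  have h4 : 0 ≤ D * (derivative N).eval a := by
    by_contra! hneg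
    have h5 : 0 < (a - v i) ^ 2 := by positivity
    have h6 := mul_neg_of_pos_of_neg hk (mul_neg_of_pos_of_neg h5 hneg)
    have h7 : 0 ≤ D ^ 2 * (1 - a * v i) := mul_nonneg (sq_nonneg _) (by linarith)
    linarith
  rw [hbasis, derivative_C_mul, eval_C_mul]
  calc (0 : ℝ) ≤ ((-1) ^ i * Lagrange.nodalWeight s v i) * (D * (derivative N).eval a) :=
        mul_nonneg hw.le h4
    _ = _ := by ring

/-- At a zero of the Chebyshev polynomial `T n`, its derivative dominates the derivative of every
polynomial of degree at most `n` which is bounded by `1` on the extremal nodes. -/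
theorem abs_eval_derivative_le_of_isRoot_T {n : ℕ} {P : ℝ[X]} (hdeg : P.natDegree ≤ n)
    (hP : ∀ x, |x| ≤ 1 → |P.eval x| ≤ 1) {a : ℝ} (ha : (T ℝ n).IsRoot a) :
    |(derivative P).eval a| ≤ |(derivative (T ℝ n)).eval a| := by
  rcases n with _ | n
  · simp [derivative_of_natDegree_zero (Nat.le_zero.mp hdeg)]
  set s := Finset.range (n + 2) with hs
  set v := node (n + 1) with hv
  have hinj : Set.InjOn v s := (strictAntiOn_node (n + 1)).injOn
  set D := (derivative (T ℝ (n + 1 : ℕ))).eval a with hD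
  have hD0 : D ≠ 0 := eval_derivative_T_ne_zero_of_isRoot ha
  have repr : ∀ Q : ℝ[X], Q.natDegree ≤ n + 1 → (derivative Q).eval a =
      ∑ i ∈ s, Q.eval (v i) * (derivative (Lagrange.basis s v i)).eval a := by
    intro Q hQ
    have h1 : Q.degree < s.card := by
      rw [hs, Finset.card_range]
      exact (degree_le_of_natDegree_le hQ).trans_lt (by norm_cast; omega)
    conv_lhs => rw [Lagrange.eq_interpolate hinj h1, Lagrange.interpolate_apply]
    simp [eval_finsetSum]
  have sign : ∀ i ∈ s, 0 ≤ D * ((-1) ^ i * (derivative (Lagrange.basis s v i)).eval a) :=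
    fun i hi => derivative_T_mul_derivative_basis_nonneg ha hi
  have hDD : D * D = ∑ i ∈ s, D * ((-1) ^ i * (derivative (Lagrange.basis s v i)).eval a) := by
    have h1 := repr (T ℝ (n + 1 : ℕ)) (by rw [natDegree_T, Int.natAbs_natCast])
    rw [← hD] at h1
    rw [← Finset.mul_sum]
    congr 1
    refine h1.trans ?_
    refine Finset.sum_congr rfl fun i hi => ?_
    rw [eval_T_real_node (by simp only [hs, Finset.mem_range, Finset.mem_Iic] at hi ⊢; omega)]
  have hle : |D| * |(derivative P).eval a| ≤ |D| * |D| := by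
    rw [← abs_mul, abs_mul_abs_self, hDD, repr P hdeg, Finset.mul_sum]
    refine (Finset.abs_sum_le_sum_abs _ _).trans (Finset.sum_le_sum fun i hi => ?_)
    have h1 : |P.eval (v i)| ≤ 1 := hP _ (abs_le.mpr node_mem_Icc)
    rw [← abs_of_nonneg (sign i hi), abs_mul, abs_mul, abs_mul D, abs_mul, abs_neg_one_pow]
    exact mul_le_mul_of_nonneg_left (mul_le_mul_of_nonneg_right h1 (abs_nonneg _)) (abs_nonneg _)
  exact le_of_mul_le_mul_left hle (abs_pos.mpr hD0)

end Polynomial.Chebyshev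

/-! ### Reflection of zeros and Markov's inequality. -/

/-- Reflecting the points `x - b` to the right half-plane increases the norm of the derivative of
a product, and of every contraction of it. -/
theorem norm_sum_mul_prod_erase_le (s : Finset ℝ) (ε : ℝ → ℝ) (hε : ∀ a ∈ s, |ε a| ≤ 1)
    (x y : ℝ) :
    ‖∑ a ∈ s, (ε a : ℂ) * ∏ b ∈ s.erase a, ((x : ℂ) + y * Complex.I - b)‖ ≤
      ‖∑ a ∈ s, ∏ b ∈ s.erase a, ((y : ℂ) * Complex.I + (|x - b| : ℝ))‖ := by
  have hsq : ∀ f : ℝ → ℂ, ‖∑ a ∈ s, f a‖ ^ 2 =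
      ∑ a ∈ s, ∑ c ∈ s, (f a * (starRingEnd ℂ) (f c)).re := by
    intro f
    have h : ((‖∑ a ∈ s, f a‖ ^ 2 : ℝ) : ℂ) = (∑ a ∈ s, f a) * (starRingEnd ℂ) (∑ a ∈ s, f a) := by
      rw [Complex.mul_conj']; push_cast; rfl
    rw [← Complex.ofReal_re (‖∑ a ∈ s, f a‖ ^ 2), h, map_sum, Finset.sum_mul_sum, Complex.re_sum]
    simp_rw [Complex.re_sum]
  have hns : ∀ b : ℝ, Complex.normSq ((x : ℂ) + y * Complex.I - b) =
      Complex.normSq ((y : ℂ) * Complex.I + (|x - b| : ℝ)) := by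
    intro b
    simp only [Complex.normSq_apply, Complex.add_re, Complex.sub_re, Complex.mul_re, Complex.add_im,
      Complex.sub_im, Complex.mul_im, Complex.ofReal_re, Complex.ofReal_im, Complex.I_re,
      Complex.I_im]
    linear_combination -abs_mul_abs_self (x - b)
  have hprod : ∀ t : Finset ℝ, Complex.normSq (∏ b ∈ t, ((x : ℂ) + y * Complex.I - b)) =
      Complex.normSq (∏ b ∈ t, ((y : ℂ) * Complex.I + (|x - b| : ℝ))) := by
    intro t
    rw [map_prod, map_prod]
    exact Finset.prod_congr rfl fun b _ => hns b
  have hterm : ∀ a ∈ s, ∀ c ∈ s,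
      |((∏ b ∈ s.erase a, ((x : ℂ) + y * Complex.I - b)) *
        (starRingEnd ℂ) (∏ b ∈ s.erase c, ((x : ℂ) + y * Complex.I - b))).re| ≤
      ((∏ b ∈ s.erase a, ((y : ℂ) * Complex.I + (|x - b| : ℝ))) *
        (starRingEnd ℂ) (∏ b ∈ s.erase c, ((y : ℂ) * Complex.I + (|x - b| : ℝ)))).re := by
    intro a ha c hc
    by_cases hac : a = c
    · subst hac
      rw [Complex.mul_conj, Complex.mul_conj, Complex.ofReal_re, Complex.ofReal_re, hprod,
        abs_of_nonneg (Complex.normSq_nonneg _)]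
    -- Off the diagonal, the factors common to both products contribute a squared modulus that
    -- reflection preserves. It remains to compare `(x-a)(x-c) + y²` with `|x-a||x-c| + y²`.
    · have split : ∀ F : ℝ → ℂ, (∏ b ∈ s.erase a, F b) * (starRingEnd ℂ) (∏ b ∈ s.erase c, F b) =
          ((Complex.normSq (∏ b ∈ (s.erase a).erase c, F b) : ℝ) : ℂ) *
            (F c * (starRingEnd ℂ) (F a)) := by
        intro F
        rw [← Finset.mul_prod_erase (s.erase a) F (Finset.mem_erase.mpr ⟨Ne.symm hac, hc⟩),
          ← Finset.mul_prod_erase (s.erase c) F (Finset.mem_erase.mpr ⟨hac, ha⟩),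
          Finset.erase_right_comm (a := c), ← Complex.mul_conj, map_mul]
        ring
      rw [split, split, Complex.re_ofReal_mul, Complex.re_ofReal_mul, ← hprod, abs_mul,
        abs_of_nonneg (Complex.normSq_nonneg _)]
      refine mul_le_mul_of_nonneg_left ?_ (Complex.normSq_nonneg _)
      simp only [Complex.mul_re, Complex.add_re, Complex.sub_re, Complex.add_im,
        Complex.sub_im, Complex.mul_im, Complex.ofReal_re, Complex.ofReal_im, Complex.I_re,
        Complex.I_im, Complex.conj_re, Complex.conj_im]
      have h1 := abs_add_le ((x - c) * (x - a)) (y * y)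
      rw [abs_mul (x - c), abs_mul_self] at h1
      refine le_trans (le_of_eq ?_) (h1.trans (le_of_eq ?_))
      · congr 1; ring
      · ring
  refine le_of_sq_le_sq ?_ (norm_nonneg _)
  rw [hsq, hsq]
  refine Finset.sum_le_sum fun a ha => Finset.sum_le_sum fun c hc => ?_
  refine le_trans ?_ (hterm a ha c hc)
  refine (le_abs_self _).trans ?_
  rw [map_mul, Complex.conj_ofReal, mul_mul_mul_comm, ← Complex.ofReal_mul, Complex.re_ofReal_mul,
    abs_mul, abs_mul]
  exact mul_le_of_le_one_left (abs_nonneg _) (mul_le_one₀ (hε a ha) (abs_nonneg _) (hε c hc))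

namespace Polynomial

theorem iterate_derivative_comp_X_add_C {R : Type*} [CommRing R] (p : R[X]) (a : R) (k : ℕ) :
    derivative^[k] (p.comp (X + C a)) = (derivative^[k] p).comp (X + C a) := by
  induction k generalizing p with
  | zero => rfl
  | succ k ih =>
    rw [Function.iterate_succ_apply, Function.iterate_succ_apply, ← ih]
    simp [derivative_comp]

namespace Chebyshev

theorem T_eq_C_mul_nodal (n : ℕ) :
    T ℝ n = Polynomial.C (T ℝ n).leadingCoeff * Lagrange.nodal (T ℝ n).roots.toFinset id := by
  have hnd : (T ℝ n).roots.Nodup := by rw [roots_T_real]; exact Finset.nodup _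
  have hcard : Multiset.card (T ℝ n).roots = (T ℝ n).natDegree := by
    rw [roots_T_real, natDegree_T, Int.natAbs_natCast, Finset.card_val]
    have h := roots_T_real_nodup n
    rw [Finset.card_image_of_injOn, Finset.card_range]
    intro i hi j hj hij
    exact Multiset.inj_on_of_nodup_map h i (by simpa using hi) j (by simpa using hj) hij
  have h := C_leadingCoeff_mul_prod_multiset_X_sub_C hcard
  conv_lhs => rw [← h]
  congr 1
  rw [Lagrange.nodal, Finset.prod, Multiset.toFinset_val, hnd.dedup]
  rfl

theorem natDegree_map_T (n : ℕ) : (T ℂ n).natDegree = n := by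
  rw [natDegree_T, Int.natAbs_natCast]

theorem lt_one_of_mem_roots_T {n : ℕ} {a : ℝ} (ha : a ∈ (T ℝ n).roots) : a < 1 := by
  rw [mem_roots (T_ne_zero ℝ n)] at ha
  have hn : n ≠ 0 := by rintro rfl; simp at ha
  have h1 : |a| ≤ 1 := by
    rw [abs_eval_T_real_le_one_iff (n := (n : ℤ)) (by exact_mod_cast hn), ha.eq_zero]; simp
  refine lt_of_le_of_ne (le_of_abs_le h1) ?_
  rintro rfl
  rw [IsRoot.def, T_eval_one] at ha
  exact one_ne_zero ha

theorem eval_T_complex_eq_prod (n : ℕ) (z : ℂ) :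
    (T ℂ n).eval z =
      ((T ℝ n).leadingCoeff : ℂ) * ∏ a ∈ (T ℝ n).roots.toFinset, (z - (a : ℂ)) := by
  have h := congrArg (fun q => eval z (q.map Complex.ofRealHom)) (T_eq_C_mul_nodal n)
  simp only [map_T] at h
  rw [h]
  simp [Lagrange.nodal, Polynomial.map_prod, eval_prod]

theorem eval_T_complex_ne_zero (n : ℕ) {z : ℂ} (hz : 1 ≤ z.re) : (T ℂ n).eval z ≠ 0 := by
  rw [eval_T_complex_eq_prod]
  refine mul_ne_zero ?_ (Finset.prod_ne_zero_iff.mpr fun a ha h => ?_)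
  · exact_mod_cast leadingCoeff_ne_zero.mpr (T_ne_zero ℝ n)
  · have h1 := lt_one_of_mem_roots_T (Multiset.mem_toFinset.mp ha)
    rw [sub_eq_zero] at h
    rw [h, Complex.ofReal_re] at hz
    linarith

/-- On every vertical line through `[-1, 1]` the derivative of a polynomial bounded by `1` on
`[-1, 1]` is dominated by the derivative of the Chebyshev polynomial on the line `re = 1`. -/
theorem norm_eval_derivative_le_norm_eval_derivative_T {n : ℕ} {P : ℝ[X]}
    (hdeg : P.natDegree ≤ n) (hP : ∀ x, |x| ≤ 1 → |P.eval x| ≤ 1) {x : ℝ} (hx : |x| ≤ 1) (y : ℝ) :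
    ‖((derivative P).map Complex.ofRealHom).eval (x + y * Complex.I)‖ ≤
      ‖(derivative (T ℂ n)).eval (1 + y * Complex.I)‖ := by
  set s := (T ℝ n).roots.toFinset with hs
  set l := (T ℝ n).leadingCoeff with hl
  have hl0 : l ≠ 0 := leadingCoeff_ne_zero.mpr (T_ne_zero ℝ n)
  have hcard : s.card = n := by
    have h := congrArg natDegree (T_eq_C_mul_nodal n)
    rw [natDegree_C_mul hl0, Lagrange.natDegree_nodal, natDegree_T, Int.natAbs_natCast] at h
    exact h.symm
  have hT' : ∀ a ∈ s, (derivative (T ℝ n)).eval a = l * ∏ b ∈ s.erase a, (a - b) := by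
    intro a ha
    have h := Lagrange.eval_nodal_derivative_eval_node_eq (v := (id : ℝ → ℝ)) ha
    conv_lhs => rw [T_eq_C_mul_nodal n, derivative_C_mul, eval_C_mul]
    rw [Lagrange.eval_nodal] at h
    exact congrArg (l * ·) h
  set ε : ℝ → ℝ := fun a => (derivative P).eval a / (derivative (T ℝ n)).eval a with hε
  have hε1 : ∀ a ∈ s, |ε a| ≤ 1 := by
    intro a ha
    rw [hε, abs_div]
    exact div_le_one_of_le₀ (abs_eval_derivative_le_of_isRoot_T hdeg hP
      ((mem_roots (T_ne_zero ℝ n)).mp (Multiset.mem_toFinset.mp ha))) (abs_nonneg _)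
  rcases Nat.eq_zero_or_pos n with hn | hn
  · rw [derivative_of_natDegree_zero (by omega)]
    simp
  -- Lagrange interpolation of `P'` at the zeros of `T_n`; the nodal weights are `l / T_n'(a)`.
  have hPrep : derivative P =
      ∑ a ∈ s, Polynomial.C (l * ε a) * Lagrange.nodal (s.erase a) id := by
    have h1 : (derivative P).degree < s.card := by
      rw [hcard]
      refine (degree_le_of_natDegree_le (natDegree_derivative_le P)).trans_lt ?_
      norm_cast
      omega
    conv_lhs => rw [Lagrange.eq_interpolate (v := (id : ℝ → ℝ)) Function.injective_id.injOn h1,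
      Lagrange.interpolate_apply]
    refine Finset.sum_congr rfl fun a ha => ?_
    rw [Lagrange.basis_eq_prod_sub_inv_mul_nodal_div ha, ← Lagrange.nodal_erase_eq_nodal_div ha,
      ← mul_assoc, ← Polynomial.C_mul]
    congr 2
    have hne : (derivative (T ℝ n)).eval a ≠ 0 := eval_derivative_T_ne_zero_of_isRoot
      ((mem_roots (T_ne_zero ℝ n)).mp (Multiset.mem_toFinset.mp ha))
    simp only [hε, Lagrange.nodalWeight, Finset.prod_inv_distrib, id]
    rw [hT' a ha] at hne ⊢
    have hne' := right_ne_zero_of_mul hne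
    field_simp
  -- The zeros `b - x` of the shifted `T_n` are moved to `-|x - b|`, which keeps `|T_n(x + it)|` on
  -- the imaginary axis.
  set Q : ℂ[X] := Polynomial.C (l : ℂ) * Lagrange.nodal s (fun b => -((|x - b| : ℝ) : ℂ)) with hQ
  set g : ℂ[X] := (T ℂ n).comp (X + Polynomial.C 1) with hg
  have hl0' : (l : ℂ) ≠ 0 := by exact_mod_cast hl0
  have hgdeg : g.natDegree = n := by
    rw [hg, natDegree_comp, natDegree_X_add_C, mul_one, natDegree_map_T]
  have hQdeg : Q.natDegree = n := by
    rw [hQ, natDegree_C_mul hl0', Lagrange.natDegree_nodal, hcard]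
  have hg0 : ∀ z : ℂ, 0 ≤ z.re → g.eval z ≠ 0 := by
    intro z hz
    rw [hg, eval_comp]
    refine eval_T_complex_ne_zero n ?_
    simpa using hz
  have hgne : g ≠ 0 := fun h => hg0 0 le_rfl (by rw [h, eval_zero])
  have hQg : ∀ t : ℝ, ‖Q.eval (t * Complex.I)‖ ≤ ‖g.eval (t * Complex.I)‖ := by
    intro t
    have h1 := norm_eval_T_le n hx t
    have h2 : ‖Q.eval (t * Complex.I)‖ = ‖(T ℂ n).eval (x + t * Complex.I)‖ := by
      rw [eval_T_complex_eq_prod, hQ, eval_C_mul, Lagrange.eval_nodal, norm_mul, norm_mul,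
        norm_prod, norm_prod]
      congr 1
      refine Finset.prod_congr rfl fun b _ => ?_
      rw [← sq_eq_sq₀ (norm_nonneg _) (norm_nonneg _), ← Complex.normSq_eq_norm_sq,
        ← Complex.normSq_eq_norm_sq]
      simp only [Complex.normSq_apply, Complex.add_re, Complex.sub_re, Complex.mul_re,
        Complex.add_im, Complex.sub_im, Complex.mul_im, Complex.ofReal_re, Complex.ofReal_im,
        Complex.I_re, Complex.I_im, Complex.neg_re, Complex.neg_im]
      linear_combination abs_mul_abs_self (x - b)
    rw [h2, hg, eval_comp]
    simpa [add_comm] using h1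
  have hQg' : ‖Q.derivative.eval (y * Complex.I)‖ ≤ ‖g.derivative.eval (y * Complex.I)‖ := by
    refine norm_eval_derivative_le_of_forall_re_nonneg (by rw [hQdeg, hgdeg]) hg0
      (fun z hz => norm_eval_le_of_forall_mul_I ?_ hg0 hQg hz) (by simp)
    rw [degree_eq_natDegree hgne, hgdeg, ← hQdeg]
    exact degree_le_natDegree
  have hkey := norm_sum_mul_prod_erase_le s ε hε1 x y
  have e1 : ((derivative P).map Complex.ofRealHom).eval (x + y * Complex.I) =
      (l : ℂ) * ∑ a ∈ s, (ε a : ℂ) * ∏ b ∈ s.erase a, ((x : ℂ) + y * Complex.I - b) := by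
    rw [hPrep, Polynomial.map_sum, eval_finsetSum, Finset.mul_sum]
    refine Finset.sum_congr rfl fun a _ => ?_
    simp [Lagrange.nodal, Polynomial.map_prod, eval_prod, mul_assoc]
  have e2 : Q.derivative.eval (y * Complex.I) =
      (l : ℂ) * ∑ a ∈ s, ∏ b ∈ s.erase a, ((y : ℂ) * Complex.I + (|x - b| : ℝ)) := by
    rw [hQ, derivative_C_mul, eval_C_mul, Lagrange.derivative_nodal, eval_finsetSum]
    congr 1
    refine Finset.sum_congr rfl fun a _ => ?_
    rw [Lagrange.eval_nodal]
    simp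
  have e3 : g.derivative.eval (y * Complex.I) =
      (derivative (T ℂ n)).eval (1 + y * Complex.I) := by
    have := iterate_derivative_comp_X_add_C (T ℂ n) 1 1
    simp only [Function.iterate_one] at this
    rw [hg, this, eval_comp]
    simp [add_comm]
  rw [← e3]
  refine le_trans ?_ hQg'
  rw [e1, e2, norm_mul, norm_mul]
  exact mul_le_mul_of_nonneg_left hkey (norm_nonneg _)

/-- **V. A. Markov's inequality**: among the polynomials of degree at most `n` bounded by `1` on
`[-1, 1]`, the Chebyshev polynomial has the largest derivatives of every order. -/
theorem abs_eval_iterate_derivative_le {n : ℕ} {P : ℝ[X]} (hdeg : P.natDegree ≤ n)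
    (hP : ∀ x, |x| ≤ 1 → |P.eval x| ≤ 1) (k : ℕ) {x : ℝ} (hx : |x| ≤ 1) :
    |(derivative^[k] P).eval x| ≤ (derivative^[k] (T ℝ n)).eval 1 := by
  rcases k with _ | k
  · simpa using hP x hx
  have hnonneg : 0 ≤ (derivative^[k + 1] (T ℝ n)).eval 1 :=
    (abs_nonneg _).trans (abs_iterate_derivative_T_real_le n (k + 1) (x := 1) (by simp))
  rcases Nat.eq_zero_or_pos n with hn | hn
  · rw [Function.iterate_succ_apply, derivative_of_natDegree_zero (by omega : P.natDegree = 0)]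
    simpa using hnonneg
  -- Only first derivatives are compared on the line; half-plane domination of `f` by `g'` carries
  -- this to the remaining `k` derivatives at `z = 0`.
  set f : ℂ[X] := ((derivative P).map Complex.ofRealHom).comp (X + Polynomial.C (x : ℂ)) with hf
  set g : ℂ[X] := (T ℂ n).comp (X + Polynomial.C 1) with hg
  have hg' : derivative g = (derivative (T ℂ n)).comp (X + Polynomial.C 1) := by
    rw [hg]
    exact iterate_derivative_comp_X_add_C (T ℂ n) 1 1
  have hgdeg : g.natDegree = n := by
    rw [hg, natDegree_comp, natDegree_X_add_C, mul_one, natDegree_map_T]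
  have hg0 : ∀ z : ℂ, 0 ≤ z.re → g.eval z ≠ 0 := by
    intro z hz
    rw [hg, eval_comp]
    refine eval_T_complex_ne_zero n ?_
    simpa using hz
  have hg'0 : ∀ z : ℂ, 0 ≤ z.re → g.derivative.eval z ≠ 0 := fun z hz =>
    eval_derivative_ne_zero_of_forall_re_nonneg (by omega) hg0 hz
  have hg'ne : derivative g ≠ 0 := fun h => hg'0 0 le_rfl (by rw [h, eval_zero])
  have hfdeg : f.natDegree ≤ (derivative g).natDegree := by
    rw [hf, natDegree_comp, natDegree_X_add_C, mul_one, natDegree_map, natDegree_derivative,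
      natDegree_derivative, hgdeg]
    omega
  have hline : ∀ t : ℝ, ‖f.eval (t * Complex.I)‖ ≤ ‖(derivative g).eval (t * Complex.I)‖ := by
    intro t
    have h1 := norm_eval_derivative_le_norm_eval_derivative_T hdeg hP hx t
    rw [hg', hf, eval_comp, eval_comp]
    simpa [add_comm] using h1
  have hfdeg' : f.degree ≤ (derivative g).degree := by
    rw [degree_eq_natDegree hg'ne]
    exact degree_le_of_natDegree_le hfdeg
  have h := norm_eval_iterate_derivative_le_of_forall_re_nonneg k hfdeg hg'0
    (fun z hz => norm_eval_le_of_forall_mul_I hfdeg' hg'0 hline hz) (z := 0) le_rfl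
  rw [hg', hf, iterate_derivative_comp_X_add_C, iterate_derivative_comp_X_add_C, eval_comp,
    eval_comp, ← Function.iterate_succ_apply derivative, ← map_T Complex.ofRealHom,
    iterate_derivative_map, iterate_derivative_map] at h
  have e : ∀ (q : ℝ[X]) (t : ℝ), ‖(q.map Complex.ofRealHom).eval (t : ℂ)‖ = |q.eval t| := by
    intro q t
    rw [← Complex.ofRealHom_eq_coe, eval_map_apply, Complex.ofRealHom_eq_coe, Complex.norm_real,
      Real.norm_eq_abs]
  simp only [eval_add, eval_X, eval_C, zero_add] at h
  rw [e, ← Complex.ofReal_one, e, abs_of_nonneg hnonneg] at h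
  exact h

end Chebyshev

end Polynomial

/-! ### Rescaling to `[0, L]` and the values `T_d^(k)(1)`. -/

namespace Polynomial

theorem iterate_derivative_comp_C_mul_X_add_C {R : Type*} [CommRing R] (p : R[X]) (a b : R)
    (k : ℕ) : derivative^[k] (p.comp (C a * X + C b)) =
      C (a ^ k) * (derivative^[k] p).comp (C a * X + C b) := by
  induction k generalizing p with
  | zero => simp
  | succ k ih =>
    have h : derivative (p.comp (C a * X + C b)) = C a * (derivative p).comp (C a * X + C b) := by
      simp [derivative_comp]
    rw [Function.iterate_succ_apply, Function.iterate_succ_apply, h, iterate_derivative_C_mul, ih,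
      ← mul_assoc, ← C_mul, pow_succ']

/-- V. A. Markov's inequality on the interval `[0, L]`. -/
theorem abs_eval_iterate_derivative_le_of_forall_mem_Icc {d : ℕ} {P : ℝ[X]}
    (hdeg : P.natDegree ≤ d) {L M : ℝ} (hL : 0 < L) (hM : 0 < M)
    (hP : ∀ t ∈ Set.Icc 0 L, |P.eval t| ≤ M) (k : ℕ) {t : ℝ} (ht : t ∈ Set.Icc 0 L) :
    |(derivative^[k] P).eval t| ≤
      (2 / L) ^ k * M * (derivative^[k] (Chebyshev.T ℝ d)).eval 1 := by
  set Q : ℝ[X] := C M⁻¹ * P.comp (C (L / 2) * X + C (L / 2)) with hQ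
  have hQdeg : Q.natDegree ≤ d := by
    refine (natDegree_C_mul_le _ _).trans (natDegree_comp_le.trans ?_)
    calc _ ≤ P.natDegree * 1 := Nat.mul_le_mul_left _ natDegree_linear_le
      _ ≤ d := by omega
  have hQ1 : ∀ x, |x| ≤ 1 → |Q.eval x| ≤ 1 := by
    intro x hx
    rw [abs_le] at hx
    have h1 := hP (L / 2 * x + L / 2) ⟨by nlinarith, by nlinarith⟩
    rw [hQ, eval_C_mul, eval_comp, abs_mul, abs_of_pos (inv_pos.mpr hM), inv_mul_le_one₀ hM]
    simpa using h1
  have hx : |2 * t / L - 1| ≤ 1 := by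
    have h0 : 0 ≤ 2 * t / L := div_nonneg (by linarith [ht.1]) hL.le
    have h1 : 2 * t / L ≤ 2 := by rw [div_le_iff₀ hL]; linarith [ht.2]
    rw [abs_le]; constructor <;> linarith
  have key := Chebyshev.abs_eval_iterate_derivative_le hQdeg hQ1 k hx
  have e : (derivative^[k] Q).eval (2 * t / L - 1) =
      M⁻¹ * ((L / 2) ^ k * (derivative^[k] P).eval t) := by
    rw [hQ, iterate_derivative_C_mul, iterate_derivative_comp_C_mul_X_add_C, eval_C_mul,
      eval_C_mul, eval_comp]
    have : L / 2 * (2 * t / L - 1) + L / 2 = t := by field_simp; ring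
    simp [this]
  rw [e, abs_mul, abs_mul, abs_of_pos (inv_pos.mpr hM), abs_of_pos (by positivity),
    inv_mul_le_iff₀ hM] at key
  have h2 : (2 / L) ^ k * (L / 2) ^ k = 1 := by
    rw [← mul_pow, div_mul_div_comm, mul_comm, div_self (by positivity), one_pow]
  calc |(derivative^[k] P).eval t| =
        (2 / L) ^ k * ((L / 2) ^ k * |(derivative^[k] P).eval t|) := by
        rw [← mul_assoc, h2, one_mul]
    _ ≤ (2 / L) ^ k * (M * (derivative^[k] (Chebyshev.T ℝ d)).eval 1) := by gcongr
    _ = _ := by ring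

theorem prod_range_two_mul_add_one_eq_doubleFactorial (k : ℕ) :
    ∏ l ∈ Finset.range (k + 1), (2 * l + 1) = Nat.doubleFactorial (2 * (k + 1) - 1) := by
  induction k with
  | zero => simp
  | succ k ih =>
    rw [Finset.prod_range_succ, ih, show 2 * (k + 1 + 1) - 1 = (2 * (k + 1) - 1) + 2 by omega,
      Nat.doubleFactorial_add_two, mul_comm]
    congr 1

namespace Chebyshev

theorem doubleFactorial_mul_iterate_derivative_T_eval_one_le (d : ℕ) {k : ℕ} (hk : 1 ≤ k) :
    (Nat.doubleFactorial (2 * k - 1) : ℝ) * (derivative^[k] (T ℝ d)).eval 1 ≤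
      ((d : ℝ) ^ 2) ^ k := by
  obtain ⟨k, rfl⟩ : ∃ j, k = j + 1 := ⟨k - 1, by omega⟩
  have h := iterate_derivative_T_eval_one (R := ℝ) (d : ℤ) (k + 1)
  rw [← prod_range_two_mul_add_one_eq_doubleFactorial]
  push_cast at h ⊢
  rw [h]
  by_cases hkd : k < d
  · calc _ ≤ ∏ _l ∈ Finset.range (k + 1), (d : ℝ) ^ 2 := by
          refine Finset.prod_le_prod (fun l hl => ?_) (fun l _ => by nlinarith [sq_nonneg (l : ℝ)])
          have : (l : ℝ) ≤ d := by
            exact_mod_cast (Nat.lt_succ_iff.mp (Finset.mem_range.mp hl)).trans hkd.le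
          nlinarith [(Nat.cast_nonneg l : (0 : ℝ) ≤ l)]
      _ = _ := by simp
  -- Once `d ≤ k` the factor `d² - l²` with `l = d` occurs; later factors are negative, so a
  -- factorwise bound would not do.
  · rw [Finset.prod_eq_zero (i := d) (Finset.mem_range.mpr (by omega)) (by ring)]
    positivity

theorem iterate_derivative_two_T_eval_one (d : ℕ) :
    3 * (derivative^[2] (T ℝ d)).eval 1 = (d : ℝ) ^ 2 * (d ^ 2 - 1) := by
  have h := iterate_derivative_T_eval_one (R := ℝ) (d : ℤ) 2
  norm_num [Finset.prod_range_succ] at h ⊢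
  exact h

end Chebyshev

/-! ### Rounding to the nearest integer. -/

/-- A polynomial at a critical point exceeds its other values by at most the quadratic term
given by a lower bound on the second derivative. -/
theorem eval_le_eval_add_of_derivative_eq_zero {q : ℝ[X]} {a b B t s : ℝ}
    (hB : ∀ r ∈ Set.Icc a b, -B ≤ (derivative^[2] q).eval r) (ht : t ∈ Set.Icc a b)
    (h0 : (derivative q).eval t = 0) (hs : s ∈ Set.Icc a b) :
    q.eval t ≤ q.eval s + B / 2 * (s - t) ^ 2 := by
  -- The added quadratic makes `h` convex on `[a, b]`, so its critical point `t` is a global minimum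
  -- there.
  set h : ℝ[X] := q + C (B / 2) * (X - C t) ^ 2 with hh
  have hd : ∀ r, (derivative h).eval r = (derivative q).eval r + B * (r - t) := by
    intro r; simp [hh, derivative_pow]; ring
  have hdd : ∀ r, (derivative (derivative h)).eval r = (derivative^[2] q).eval r + B := by
    intro r; simp [hh, derivative_pow]
  have hmono : MonotoneOn (fun r => (derivative h).eval r) (Set.Icc a b) := by
    refine monotoneOn_of_deriv_nonneg (convex_Icc a b) (derivative h).continuous.continuousOn
      (derivative h).differentiable.differentiableOn fun r hr => ?_
    rw [interior_Icc] at hr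
    rw [Polynomial.deriv, hdd]
    linarith [hB r ⟨hr.1.le, hr.2.le⟩]
  have hdt : (derivative h).eval t = 0 := by rw [hd, h0]; ring
  have key : h.eval t ≤ h.eval s := by
    rcases le_total t s with hts | hts
    · refine monotoneOn_of_deriv_nonneg (convex_Icc t s) h.continuous.continuousOn
        h.differentiable.differentiableOn (fun r hr => ?_) (Set.left_mem_Icc.mpr hts)
        (Set.right_mem_Icc.mpr hts) hts
      rw [interior_Icc] at hr
      rw [Polynomial.deriv, ← hdt]
      exact hmono ht ⟨ht.1.trans hr.1.le, hr.2.le.trans hs.2⟩ hr.1.le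
    · refine antitoneOn_of_deriv_nonpos (convex_Icc s t) h.continuous.continuousOn
        h.differentiable.differentiableOn (fun r hr => ?_) (Set.left_mem_Icc.mpr hts)
        (Set.right_mem_Icc.mpr hts) hts
      rw [interior_Icc] at hr
      rw [Polynomial.deriv, ← hdt]
      exact hmono ⟨hs.1.trans hr.1.le, hr.2.le.trans ht.2⟩ ht hr.2.le
  have e1 : h.eval t = q.eval t := by simp [hh]
  have e2 : h.eval s = q.eval s + B / 2 * (s - t) ^ 2 := by simp [hh]
  rwa [e1, e2] at key

theorem exists_nat_le_abs_sub_le_half {n : ℕ} {t : ℝ} (ht : t ∈ Set.Icc (0 : ℝ) n) :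
    ∃ i ≤ n, |(i : ℝ) - t| ≤ 1 / 2 := by
  have h1 := Nat.floor_le ht.1
  have h2 := Nat.lt_floor_add_one t
  have h3 : ⌊t⌋₊ ≤ n := Nat.floor_le_of_le ht.2
  rcases le_total (t - ⌊t⌋₊) (1 / 2) with h | h
  · exact ⟨⌊t⌋₊, h3, by rw [abs_le]; constructor <;> linarith⟩
  · refine ⟨⌊t⌋₊ + 1, ?_, by push_cast; rw [abs_le]; constructor <;> linarith⟩
    have : (⌊t⌋₊ : ℝ) < n := by linarith [ht.2]
    exact_mod_cast this

/-- The rounding step: a polynomial bounded by `1 / 2` at the integers of `[0, n]`, with second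
derivative bounded by `B`, is bounded by `1 / 2 + B / 8` at a maximum of its absolute value. -/
theorem abs_eval_le_of_isMaxOn {q : ℝ[X]} {n : ℕ} {B t : ℝ}
    (hq : ∀ i ≤ n, |q.eval (i : ℝ)| ≤ 1 / 2)
    (hB : ∀ r ∈ Set.Icc (0 : ℝ) n, |(derivative^[2] q).eval r| ≤ B)
    (ht : t ∈ Set.Icc (0 : ℝ) n) (hmax : ∀ r ∈ Set.Icc (0 : ℝ) n, |q.eval r| ≤ |q.eval t|) :
    |q.eval t| ≤ 1 / 2 + B / 8 := by
  have hB0 : 0 ≤ B := (abs_nonneg _).trans (hB t ht)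
  wlog hpos : 0 ≤ q.eval t generalizing q
  · have e : derivative^[2] (-q) = -derivative^[2] q := by simp
    have := this (q := -q) (by simpa using hq) (by rw [e]; simpa using hB) (by simpa using hmax)
      (by rw [eval_neg]; linarith)
    simpa using this
  -- Endpoints are integers, so the bound `1/2` applies there; an interior maximum is critical.
  rcases eq_or_lt_of_le ht.1 with h0 | h0
  · rw [← h0]
    have := hq 0 (Nat.zero_le n)
    rw [Nat.cast_zero] at this
    linarith
  rcases eq_or_lt_of_le ht.2 with hn | hn
  · rw [hn]
    linarith [hq n le_rfl]
  have hloc : IsLocalMax (fun r => q.eval r) t := by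
    filter_upwards [Icc_mem_nhds h0 hn] with r hr
    have := hmax r hr
    rw [abs_of_nonneg hpos] at this
    exact (le_abs_self _).trans this
  have hder : (derivative q).eval t = 0 := by
    rw [← Polynomial.deriv]; exact hloc.deriv_eq_zero
  obtain ⟨i, hi, hit⟩ := exists_nat_le_abs_sub_le_half ht
  have h1 := eval_le_eval_add_of_derivative_eq_zero (s := (i : ℝ))
    (fun r hr => (abs_le.mp (hB r hr)).1) ht hder ⟨Nat.cast_nonneg i, by exact_mod_cast hi⟩
  have h2 : ((i : ℝ) - t) ^ 2 ≤ 1 / 4 := by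
    rw [← sq_abs]
    calc |(i : ℝ) - t| ^ 2 ≤ (1 / 2) ^ 2 := by gcongr
      _ = 1 / 4 := by norm_num
  have h3 := (abs_le.mp (hq i hi)).2
  rw [abs_of_nonneg hpos]
  nlinarith

end Polynomial

/-! ### The main inequality. -/

theorem mainTheorem8 (p : Polynomial ℝ) (n d k : ℕ) (c : ℝ)
    (hd : p.natDegree = d) (hk : 1 ≤ k)
    (hdc : d ≠ 0 ∨ c ≠ 0)
    (hp : ∀ i : ℕ, i ≤ n → 0 ≤ p.eval (i : ℝ) ∧ p.eval (i : ℝ) ≤ 1)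
    (hc : c ≤ sSup ((fun t : ℝ => |(Polynomial.derivative^[k] p).eval t|) ''
      Set.Icc (0 : ℝ) (n : ℝ))) :
    Real.sqrt 6 * (n : ℝ) ≤ (d : ℝ) ^ 2 ∨
      (1 - ((d : ℝ) ^ 2 / (n : ℝ)) ^ 2 / 6) *
          ((Nat.doubleFactorial (2 * k - 1) : ℝ) / (2 : ℝ) ^ (k - 1)) * c
        < ((d : ℝ) ^ 2 / (n : ℝ)) ^ k := by
  rw [or_iff_not_imp_left, not_le]
  intro hlt
  obtain ⟨k, rfl⟩ : ∃ j, k = j + 1 := ⟨k - 1, by omega⟩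
  have hn : (0 : ℝ) < n := by
    rcases Nat.eq_zero_or_pos n with rfl | h
    · exact absurd hlt (by simp)
    · exact_mod_cast h
  have hne : (Set.Icc (0 : ℝ) n).Nonempty := Set.nonempty_Icc.mpr hn.le
  have hdf : (0 : ℝ) < Nat.doubleFactorial (2 * (k + 1) - 1) := by
    exact_mod_cast Nat.doubleFactorial_pos _
  rcases Nat.eq_zero_or_pos d with rfl | hd0
  -- For `d = 0` the derivative vanishes, so `c ≤ 0`, and `c ≠ 0` makes the inequality strict.
  · have hder : derivative^[k + 1] p = 0 := by
      rw [Function.iterate_succ_apply, derivative_of_natDegree_zero hd, iterate_derivative_zero]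
    have hc0 : c ≤ 0 := by
      refine hc.trans (csSup_le (hne.image _) ?_)
      rintro _ ⟨t, _, rfl⟩
      simp [hder]
    have hc1 : c < 0 := lt_of_le_of_ne hc0 (hdc.resolve_left (by simp))
    simp only [Nat.cast_zero, ne_eq, OfNat.ofNat_ne_zero, not_false_eq_true, zero_pow, zero_div,
      sub_zero, one_mul, Nat.add_eq_zero_iff, one_ne_zero, and_false]
    exact mul_neg_of_pos_of_neg (by positivity) hc1
  set x : ℝ := (d : ℝ) ^ 2 / n with hx
  have hxpos : 0 < x := by positivity
  have hx6 : x ^ 2 < 6 := by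
    have h1 : x < Real.sqrt 6 := by rw [hx, div_lt_iff₀ hn]; exact hlt
    calc x ^ 2 < Real.sqrt 6 ^ 2 := by gcongr
      _ = 6 := Real.sq_sqrt (by norm_num)
  set q : ℝ[X] := p - C (1 / 2) with hq
  have hqdeg : q.natDegree ≤ d := by rw [hq, natDegree_sub_C, hd]
  have hqder : ∀ j, derivative^[j + 1] q = derivative^[j + 1] p := by
    intro j
    rw [Function.iterate_succ_apply, Function.iterate_succ_apply, hq, derivative_sub, derivative_C,
      sub_zero]
  obtain ⟨t, ht, hmax⟩ := isCompact_Icc.exists_isMaxOn hne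
    (f := fun r => |q.eval r|) q.continuous.abs.continuousOn
  set M : ℝ := |q.eval t| with hM
  have hmax' : ∀ r ∈ Set.Icc (0 : ℝ) n, |q.eval r| ≤ M := fun r hr => hmax hr
  have hMpos : 0 < M := by
    refine lt_of_le_of_ne (abs_nonneg _) fun h => ?_
    have hq0 : q = 0 := by
      refine eq_zero_of_infinite_isRoot q ((Set.Icc_infinite hn).mono fun r hr => ?_)
      have := hmax' r hr
      rw [← h] at this
      exact abs_nonpos_iff.mp this
    have : p.natDegree = 0 := by
      rw [sub_eq_zero.mp (hq.symm.trans hq0), natDegree_C]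
    omega
  have hV : ∀ j, ∀ r ∈ Set.Icc (0 : ℝ) n, |(derivative^[j] q).eval r| ≤
      (2 / n) ^ j * M * (derivative^[j] (Chebyshev.T ℝ d)).eval 1 := fun j r hr =>
    abs_eval_iterate_derivative_le_of_forall_mem_Icc hqdeg hn hMpos hmax' j hr
  have hround := abs_eval_le_of_isMaxOn (q := q) (n := n) (t := t) (fun i hi => by
    have := hp i hi
    rw [hq, eval_sub, eval_C, abs_le]
    constructor <;> linarith) (hV 2) ht hmax'
  rw [← hM] at hround
  -- Strictness comes from the `-1` in `d²(d² - 1)`, as `M` and `d` are positive.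
  have hMx : M * (1 - x ^ 2 / 6) < 1 / 2 := by
    have h1 : (2 / (n : ℝ)) ^ 2 * M * (derivative^[2] (Chebyshev.T ℝ d)).eval 1 / 8 =
        M * (x ^ 2 / 6) - M * ((d : ℝ) ^ 2 / (6 * n ^ 2)) := by
      have h2 : (derivative^[2] (Chebyshev.T ℝ d)).eval 1 = (d : ℝ) ^ 2 * (d ^ 2 - 1) / 3 := by
        rw [eq_div_iff (by norm_num), ← Chebyshev.iterate_derivative_two_T_eval_one, mul_comm]
      rw [h2, hx]
      field_simp
      ring
    have h3 : 0 < M * ((d : ℝ) ^ 2 / (6 * n ^ 2)) := by positivity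
    linarith
  have hcle : c ≤ (2 / n) ^ (k + 1) * M * (derivative^[k + 1] (Chebyshev.T ℝ d)).eval 1 := by
    refine hc.trans (csSup_le (hne.image _) ?_)
    rintro _ ⟨r, hr, rfl⟩
    rw [← hqder]
    exact hV (k + 1) r hr
  have hT := Chebyshev.doubleFactorial_mul_iterate_derivative_T_eval_one_le d hk
  set D : ℝ := (Nat.doubleFactorial (2 * (k + 1) - 1) : ℝ) with hD
  set τ : ℝ := (derivative^[k + 1] (Chebyshev.T ℝ d)).eval 1 with hτ
  have hx1 : 0 < 1 - x ^ 2 / 6 := by linarith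
  rw [Nat.add_sub_cancel]
  calc (1 - x ^ 2 / 6) * (D / 2 ^ k) * c
      -- The sign of `c` is irrelevant: only its coefficient must be nonnegative.
      ≤ (1 - x ^ 2 / 6) * (D / 2 ^ k) * ((2 / n) ^ (k + 1) * M * τ) := by gcongr
    _ = (M * (1 - x ^ 2 / 6)) * (2 * (1 / n) ^ (k + 1)) * (D * τ) := by
        have e : (2 / (n : ℝ)) ^ (k + 1) = 2 * 2 ^ k * (1 / n) ^ (k + 1) := by
          rw [div_eq_mul_one_div, mul_pow, pow_succ]; ring
        rw [e]
        clear_value x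
        field_simp
    _ ≤ (M * (1 - x ^ 2 / 6)) * (2 * (1 / n) ^ (k + 1)) * ((d : ℝ) ^ 2) ^ (k + 1) := by gcongr
    _ = (M * (1 - x ^ 2 / 6)) * 2 * x ^ (k + 1) := by
        rw [hx, div_pow, one_div_pow]
        ring
    _ < 1 * x ^ (k + 1) := by
        gcongr
        linarith
    _ = x ^ (k + 1) := one_mul _
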